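/- Let $\mathbf N=\{1,2,\dots\}$ and let $S$ be the facial monoid, given by the monoid presentation with generators $s_i$ ($i\in\mathbf N$) and relations $s_j s_i=s_i s_{j+1}$ for all $1\le i\le j$. Let $T$ be either the free abelian monoid on $\mathbf N$ or the free abelian group on $\mathbf N$; write $t\in T$ as $t=(t_n)_{n\in\mathbf N}$, where all but finitely many of the integers $t_n$ (non-negative in the monoid case) are zero. Let $S$ act on $T$ from the right by the endomorphisms determined by $$(t^{s_i})_n=\begin{cases} t_n & \text{if } n\le i,\\ 0 & \text{if } n=i+1,\\ t_{n-1} & \text{if } n\ge i+2.\end{cases}$$ The right semi-direct product $S\ltimes T$ is the set $S\times T$ with the multiplication $(s,t)(s',t')=(ss',\,t^{s'}t')$, where the operation of $T$ is written multiplicatively. Then, for both choices of $T$, the monoid $M=S\ltimes T$ is amenable. That is, $M$ satisfies the following conditions (which are equivalent by a theorem of Day): 1. for every Hausdorff real topological vector space $V$, every action of $M$ on $V$ by continuous affine transformations and every non-empty convex compact set $K\subseteq V$ preserved by $M$, there is a point of $K$ fixed by $M$; 2. there is a left-invariant mean on $M$, i.e. a positive normalized linear functional $m$ on $\ell^\infty(M)$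 such that $m(x\mapsto f(ax))=m(f)$ for all $a\in M$ and $f\in\ell^\infty(M)$; 3. for every finite set $A\subseteq M$ and every $\epsilon>0$ there is a finitely supported probability distribution $\mu$ on $M$ such that $\|a\mu-\mu\|_1<\epsilon$ for all $a\in A$, where $a\mu$ is the image of $\mu$ under left multiplication by $a$. -/

import Mathlib

open scoped ENNReal

universe u v

/-! ### Amenability of monoids -/

/-- Every non-empty convex compact `M`-space has a fixed point. A convex compact `M`-space is a
convex compact subset `K` of a (real) Hausdorff topological vector space `V`, not assumed locally
convex, together with an action of `M` on `V` by continuous affine maps preserving `K`. -/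
def HasFixedPointProperty (M : Type u) [Monoid M] : Prop :=
  ∀ (V : Type v) [AddCommGroup V] [Module ℝ V] [TopologicalSpace V] [IsTopologicalAddGroup V]
    [ContinuousSMul ℝ V] [T2Space V] (act : M → V →ᴬ[ℝ] V),
    (∀ x, act 1 x = x) → (∀ a b x, act (a * b) x = act a (act b x)) →
    ∀ K : Set V, K.Nonempty → IsCompact K → Convex ℝ K → (∀ a, ∀ x ∈ K, act a x ∈ K) →
      ∃ x ∈ K, ∀ a, act a x = x

/-- The left translate `x ↦ f (a x)` of a bounded function `f` on a monoid. -/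
def leftTranslate {M : Type u} [Monoid M] (a : M) (f : lp (fun _ : M => ℝ) ∞) :
    lp (fun _ : M => ℝ) ∞ :=
  ⟨fun x => f (a * x), memℓp_infty <| by
    obtain ⟨C, hC⟩ := memℓp_infty_iff.1 f.2
    refine ⟨C, ?_⟩
    rintro _ ⟨x, rfl⟩
    exact hC ⟨a * x, rfl⟩⟩

/-- There is a left-invariant mean on `M`: a positive normalized linear functional on `ℓ^∞(M)`
invariant under left translations. -/
def HasLeftInvariantMean (M : Type u) [Monoid M] : Prop :=
  ∃ m : lp (fun _ : M => ℝ) ∞ →ₗ[ℝ] ℝ,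
    (∀ f : lp (fun _ : M => ℝ) ∞, (∀ x, 0 ≤ f x) → 0 ≤ m f) ∧ m 1 = 1 ∧
      ∀ a f, m (leftTranslate a f) = m f

/-- For every finite `A ⊆ M` and `ε > 0` there is a finitely supported probability distribution
`μ` on `M` such that `‖a μ - μ‖₁ < ε` for all `a ∈ A`, where `a μ` is the image of `μ` under left
multiplication by `a`. -/
def HasReiterProperty (M : Type u) [Monoid M] : Prop :=
  ∀ (A : Finset M) (ε : ℝ), 0 < ε →
    ∃ μ : M →₀ ℝ, (∀ x, 0 ≤ μ x) ∧ (μ.sum fun _ r => r) = 1 ∧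
      ∀ a ∈ A, ((μ.mapDomain (fun x => a * x) - μ).sum fun _ r => |r|) < ε

/-- (Left) amenability of a monoid. The three conditions are equivalent by a theorem of Day; since
that theorem is not available here, all three are required. -/
structure IsAmenable (M : Type u) [Monoid M] : Prop where
  fixedPoint : HasFixedPointProperty.{u, v} M
  leftInvariantMean : HasLeftInvariantMean M
  reiter : HasReiterProperty M

/-! ### Right semi-direct products -/

/-- The right semi-direct product `S ⋉ T` of monoids, for a right action `φ` of `S` on `T` by
endomorphisms, that is, a homomorphism from `S` to the opposite of the monoid `End T`. -/
@[ext]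
structure RightSemidirectProduct (S T : Type*) [Monoid S] [Monoid T]
    (φ : S →* (Monoid.End T)ᵐᵒᵖ) where
  left : S
  right : T

namespace RightSemidirectProduct

variable {S T : Type*} [Monoid S] [Monoid T] {φ : S →* (Monoid.End T)ᵐᵒᵖ}

/-- The product `(s, t) (s', t') = (s s', t ^ s' t')`. -/
instance : Mul (RightSemidirectProduct S T φ) :=
  ⟨fun p q => ⟨p.left * q.left, (φ q.left).unop p.right * q.right⟩⟩

instance : One (RightSemidirectProduct S T φ) := ⟨⟨1, 1⟩⟩

theorem mul_def (p q : RightSemidirectProduct S T φ) :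
    p * q = ⟨p.left * q.left, (φ q.left).unop p.right * q.right⟩ := rfl

theorem one_def : (1 : RightSemidirectProduct S T φ) = ⟨1, 1⟩ := rfl

instance : Monoid (RightSemidirectProduct S T φ) where
  mul_assoc p q r := by
    simp [mul_def, mul_assoc]
  one_mul p := by
    simp [mul_def, one_def]
  mul_one p := by
    simp [mul_def, one_def]

end RightSemidirectProduct

/-! ### The facial monoid and its right action

Here `ℕ+` is the set `{1, 2, …}`. -/

/-- The relations `s_j s_i = s_i s_{j+1}` for `1 ≤ i ≤ j`. -/
inductive FacialRel : FreeMonoid ℕ+ → FreeMonoid ℕ+ → Prop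
  | face (i j : ℕ+) (h : i ≤ j) :
      FacialRel (FreeMonoid.of j * FreeMonoid.of i) (FreeMonoid.of i * FreeMonoid.of (j + 1))

/-- The facial monoid, generated by `s_i` (`i ≥ 1`) subject to the relations `FacialRel`. -/
abbrev FacialMonoid : Type := PresentedMonoid FacialRel

section Action

variable (R : Type*) [AddCommMonoid R]

variable {R} in
theorem insertZero_finite (i : ℕ+) (t : ℕ+ →₀ R) :
    (Function.support fun n : ℕ+ =>
      if n ≤ i then t n else if n = i + 1 then 0 else t (n - 1)).Finite := by
  have ht : (Function.support t).Finite := t.hasFiniteSupport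
  refine (ht.union (ht.image (· + 1))).subset fun n hn => ?_
  simp only [Function.mem_support] at hn
  split_ifs at hn with h₁ h₂
  · exact Or.inl hn
  · exact absurd rfl hn
  · have h : n - 1 + 1 = n := by
      rw [add_comm]
      exact PNat.add_sub_of_lt (lt_of_le_of_lt (one_le (a := i)) (not_le.1 h₁))
    exact Or.inr ⟨n - 1, hn, h⟩

/-- The endomorphism `t ↦ t ^ {s_i}`: insert a `0` as the `(i+1)`-st entry of `t`. -/
noncomputable def insertZero (i : ℕ+) : (ℕ+ →₀ R) →+ (ℕ+ →₀ R) where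
  toFun t := Finsupp.ofSupportFinite
    (fun n => if n ≤ i then t n else if n = i + 1 then 0 else t (n - 1)) (insertZero_finite i t)
  map_zero' := by
    ext n
    simp [Finsupp.ofSupportFinite_coe]
  map_add' t t' := by
    ext n
    simp only [Finsupp.ofSupportFinite_coe, Finsupp.add_apply]
    split_ifs <;> simp

theorem insertZero_apply (i : ℕ+) (t : ℕ+ →₀ R) (n : ℕ+) :
    insertZero R i t n = if n ≤ i then t n else if n = i + 1 then 0 else t (n - 1) := rfl

theorem insertZero_comm (i j : ℕ+) (h : i ≤ j) (t : ℕ+ →₀ R) :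
    insertZero R i (insertZero R j t) = insertZero R (j + 1) (insertZero R i t) := by
  have key : ∀ a b : ℕ+, a = b ↔ (a : ℕ) = b := fun a b => PNat.coe_inj.symm
  ext n
  simp only [insertZero_apply]
  simp only [key, ← PNat.coe_le_coe, PNat.add_coe, PNat.sub_coe, PNat.one_coe,
    ← PNat.coe_lt_coe] at h ⊢
  have h0 := n.pos
  have h1 := i.pos
  split_ifs <;> first | rfl | omega

/-- `insertZero R i` as an endomorphism of `ℕ+ →₀ R` written multiplicatively. -/
noncomputable def insertOne (i : ℕ+) : Monoid.End (Multiplicative (ℕ+ →₀ R)) :=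
  AddMonoidHom.toMultiplicative (insertZero R i)

theorem insertOne_apply (i : ℕ+) (t : Multiplicative (ℕ+ →₀ R)) :
    insertOne R i t = Multiplicative.ofAdd (insertZero R i t.toAdd) := rfl

theorem insertOne_comm (i j : ℕ+) (h : i ≤ j) :
    insertOne R i * insertOne R j = insertOne R (j + 1) * insertOne R i :=
  MonoidHom.ext fun t => congrArg Multiplicative.ofAdd (insertZero_comm R i j h t.toAdd)

/-- The right action of the facial monoid on `ℕ+ →₀ R`, written multiplicatively, in which the
generator `s_i` acts by `insertZero R i`. -/
noncomputable def facialAction :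
    FacialMonoid →* (Monoid.End (Multiplicative (ℕ+ →₀ R)))ᵐᵒᵖ :=
  PresentedMonoid.lift (rels := FacialRel) (fun i => MulOpposite.op (insertOne R i)) <| by
    intro x y hxy
    obtain ⟨i, j, h⟩ := hxy
    simp only [map_mul, FreeMonoid.lift_eval_of, ← MulOpposite.op_mul]
    exact congrArg MulOpposite.op (insertOne_comm R i j h)

theorem facialAction_of (i : ℕ+) (t : ℕ+ →₀ R) :
    (facialAction R (PresentedMonoid.of FacialRel i)).unop (Multiplicative.ofAdd t) =
      Multiplicative.ofAdd (insertZero R i t) := rfl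

end Action

/-! Everything reduces to a finitely additive mean on $M$ invariant under left translations.

For $S$, index the generators from $0$ and let $\mu_n$ be the law of $s_{n-1}^{g_{n-1}}\cdots
s_0^{g_0}$, each exponent being averaged by a shift-invariant mean on $\mathbf N$. Left
multiplication by $s_i$ moves through $s_n^{g_n}\cdots s_{i+1}^{g_{i+1}}$, lowering each index by
one, and leaves $s_i^{g_{i+1}+1+g_i}$ in the middle. The mean over $g_{i+1}$, taken with $g_i$
fixed, absorbs $1+g_i$. Hence $s_i\mu_{n+1}=\mu_n$ for $i<n$ (`faceMean_succ_eval_mul`), and a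
shift-invariant average of the $\mu_n$ is invariant.

As $T$ is commutative it has an invariant mean, and the two means combine to one on $S\ltimes T$
(`RightSemidirectProduct.exists_isInvariantUnder`). Day's conditions follow: Hahn–Banach separation
gives almost invariant finitely supported measures, and these give fixed points by compactness. -/

/-! ### Finitely additive means -/

/-- A real function is bounded. -/
def IsBddFun {α : Type*} (f : α → ℝ) : Prop := ∃ C, ∀ x, |f x| ≤ C

namespace IsBddFun

variable {α β : Type*} {f g : α → ℝ}

theorem comp (hf : IsBddFun f) (h : β → α) : IsBddFun fun x => f (h x) :=
  hf.imp fun _ hC x => hC (h x)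

theorem add (hf : IsBddFun f) (hg : IsBddFun g) : IsBddFun fun x => f x + g x := by
  obtain ⟨C, hC⟩ := hf
  obtain ⟨D, hD⟩ := hg
  exact ⟨C + D, fun x => (abs_add_le _ _).trans (add_le_add (hC x) (hD x))⟩

theorem const_mul (c : ℝ) (hf : IsBddFun f) : IsBddFun fun x => c * f x := by
  obtain ⟨C, hC⟩ := hf
  exact ⟨|c| * C, fun x => by rw [abs_mul]; gcongr; exact hC x⟩

theorem neg (hf : IsBddFun f) : IsBddFun fun x => -f x := by
  simpa using hf.const_mul (-1)

theorem sub (hf : IsBddFun f) (hg : IsBddFun g) : IsBddFun fun x => f x - g x := by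
  simpa [sub_eq_add_neg] using hf.add hg.neg

theorem const (c : ℝ) : IsBddFun fun _ : α => c := ⟨|c|, fun _ => le_rfl⟩

end IsBddFun

/-- A finitely additive mean on `α`: a positive normalized functional on real functions which is
linear on bounded functions (its values on unbounded functions are irrelevant). -/
structure FinAddMean (α : Type*) where
  eval : (α → ℝ) → ℝ
  eval_add : ∀ f g, IsBddFun f → IsBddFun g → eval (fun x => f x + g x) = eval f + eval g
  eval_const_mul : ∀ (c : ℝ) f, IsBddFun f → eval (fun x => c * f x) = c * eval f
  eval_nonneg : ∀ f, IsBddFun f → (∀ x, 0 ≤ f x) → 0 ≤ eval f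
  eval_one : eval (fun _ => 1) = 1

namespace FinAddMean

variable {α β : Type*}

theorem eval_const (m : FinAddMean α) (c : ℝ) : m.eval (fun _ => c) = c := by
  simpa [m.eval_one] using m.eval_const_mul c _ (.const 1)

theorem eval_sub (m : FinAddMean α) {f g : α → ℝ} (hf : IsBddFun f) (hg : IsBddFun g) :
    m.eval (fun x => f x - g x) = m.eval f - m.eval g := by
  have h := m.eval_add _ _ hf (hg.const_mul (-1))
  rw [m.eval_const_mul _ _ hg] at h
  simpa [sub_eq_add_neg] using h

theorem eval_mono (m : FinAddMean α) {f g : α → ℝ} (hf : IsBddFun f) (hg : IsBddFun g)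
    (h : ∀ x, f x ≤ g x) : m.eval f ≤ m.eval g := by
  have := m.eval_nonneg _ (hg.sub hf) fun x => sub_nonneg.2 (h x)
  rwa [m.eval_sub hg hf, sub_nonneg] at this

theorem abs_eval_le (m : FinAddMean α) {f : α → ℝ} {C : ℝ} (h : ∀ x, |f x| ≤ C) :
    |m.eval f| ≤ C := by
  have hf : IsBddFun f := ⟨C, h⟩
  rw [abs_le]
  constructor
  · simpa [m.eval_const] using m.eval_mono (.const (-C)) hf fun x => (abs_le.1 (h x)).1
  · simpa [m.eval_const] using m.eval_mono hf (.const C) fun x => (abs_le.1 (h x)).2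

theorem isBddFun_eval (k : α → FinAddMean β) {f : α → β → ℝ} (hf : ∃ C, ∀ x y, |f x y| ≤ C) :
    IsBddFun fun a => (k a).eval (f a) :=
  hf.imp fun _ hC a => (k a).abs_eval_le (hC a)

theorem eval_sum (m : FinAddMean α) {ι : Type*} (s : Finset ι) (f : ι → α → ℝ)
    (hf : ∀ i, IsBddFun (f i)) :
    IsBddFun (fun x => ∑ i ∈ s, f i x) ∧
      m.eval (fun x => ∑ i ∈ s, f i x) = ∑ i ∈ s, m.eval (f i) := by
  classical
  induction s using Finset.induction_on with
  | empty => simpa [m.eval_const] using IsBddFun.const (α := α) 0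
  | insert i s hi ih =>
    simp only [Finset.sum_insert hi]
    exact ⟨(hf i).add ih.1, by rw [m.eval_add _ _ (hf i) ih.1, ih.2]⟩

/-- The point mass at `a`. -/
def pure (a : α) : FinAddMean α where
  eval f := f a
  eval_add _ _ _ _ := rfl
  eval_const_mul _ _ _ := rfl
  eval_nonneg _ _ h := h a
  eval_one := rfl

/-- The mixture of the means `k a`, with `a` distributed according to `m`. -/
def bind (m : FinAddMean α) (k : α → FinAddMean β) : FinAddMean β where
  eval f := m.eval fun a => (k a).eval f
  eval_add f g hf hg := by
    simp_rw [fun a => (k a).eval_add f g hf hg]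
    exact m.eval_add _ _ (isBddFun_eval k (hf.imp fun _ h _ => h))
      (isBddFun_eval k (hg.imp fun _ h _ => h))
  eval_const_mul c f hf := by
    simp_rw [fun a => (k a).eval_const_mul c f hf]
    exact m.eval_const_mul c _ (isBddFun_eval k (hf.imp fun _ h _ => h))
  eval_nonneg f hf h :=
    m.eval_nonneg _ (isBddFun_eval k (hf.imp fun _ h _ => h)) fun a => (k a).eval_nonneg f hf h
  eval_one := by simp_rw [fun a => (k a).eval_one]; exact m.eval_one

/-- The image of a mean under a function. -/
def map (h : α → β) (m : FinAddMean α) : FinAddMean β := m.bind fun a => pure (h a)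

/-! ### Limits along ultrafilters and the Cesàro mean on $\mathbf N$. -/

open Filter Topology

theorem exists_tendsto_ultrafilter (U : Ultrafilter α) {f : α → ℝ} (hf : IsBddFun f) :
    ∃ l, Tendsto f U (𝓝 l) := by
  obtain ⟨C, hC⟩ := hf
  obtain ⟨l, -, hl⟩ := (isCompact_Icc (a := -C) (b := C)).ultrafilter_le_nhds' (U.map f)
    (Ultrafilter.mem_map.2 (Filter.univ_mem' fun x => abs_le.1 (hC x)))
  exact ⟨l, hl⟩

/-- The limit along an ultrafilter. -/
noncomputable def ofUltrafilter (U : Ultrafilter α) : FinAddMean α where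
  eval f := limUnder (U : Filter α) f
  eval_add f g hf hg := by
    obtain ⟨a, ha⟩ := exists_tendsto_ultrafilter U hf
    obtain ⟨b, hb⟩ := exists_tendsto_ultrafilter U hg
    rw [ha.limUnder_eq, hb.limUnder_eq, (ha.add hb).limUnder_eq]
  eval_const_mul c f hf := by
    obtain ⟨a, ha⟩ := exists_tendsto_ultrafilter U hf
    rw [ha.limUnder_eq, (ha.const_mul c).limUnder_eq]
  eval_nonneg f hf h := by
    obtain ⟨a, ha⟩ := exists_tendsto_ultrafilter U hf
    rw [ha.limUnder_eq]
    exact ge_of_tendsto' ha h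
  eval_one := tendsto_const_nhds.limUnder_eq

theorem ofUltrafilter_eval_eq (U : Ultrafilter α) {f g : α → ℝ} (hf : IsBddFun f)
    (hg : IsBddFun g) (h : Tendsto (fun x => f x - g x) U (𝓝 0)) :
    (ofUltrafilter U).eval f = (ofUltrafilter U).eval g := by
  rw [← sub_eq_zero, ← eval_sub _ hf hg]
  exact h.limUnder_eq

/-- The uniform distribution on `{0, …, n}`. -/
noncomputable def uniformRange (n : ℕ) : FinAddMean ℕ where
  eval f := (∑ k ∈ Finset.range (n + 1), f k) / (n + 1)
  eval_add f g _ _ := by rw [Finset.sum_add_distrib, add_div]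
  eval_const_mul c f _ := by rw [← Finset.mul_sum, mul_div_assoc]
  eval_nonneg f _ h := div_nonneg (Finset.sum_nonneg fun k _ => h k) (by positivity)
  eval_one := by simp [div_self (Nat.cast_add_one_ne_zero (R := ℝ) n)]

/-- A translation invariant mean on `ℕ`. -/
noncomputable def cesaro : FinAddMean ℕ := (ofUltrafilter (hyperfilter ℕ)).bind uniformRange

theorem cesaro_eval_succ {f : ℕ → ℝ} (hf : IsBddFun f) :
    cesaro.eval (fun n => f (n + 1)) = cesaro.eval f := by
  refine ofUltrafilter_eval_eq _ (isBddFun_eval _ ((hf.comp _).imp fun _ h _ => h))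
    (isBddFun_eval _ (hf.imp fun _ h _ => h)) ?_
  refine Tendsto.mono_left ?_ Nat.hyperfilter_le_atTop
  obtain ⟨C, hC⟩ := hf
  -- The sum telescopes, so a shift changes the average over $\{0,\dots,n\}$ by $O(1/n)$.
  have key : ∀ n : ℕ, (uniformRange n).eval (fun n => f (n + 1)) - (uniformRange n).eval f =
      (f (n + 1) - f 0) / (n + 1) := fun n => by
    simp only [uniformRange]
    rw [← sub_div, ← Finset.sum_sub_distrib, Finset.sum_range_sub]
  simp_rw [key]
  refine squeeze_zero_norm (a := fun n : ℕ => (2 * C) * (1 / ((n : ℝ) + 1))) (fun n => ?_) ?_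
  · have hn : (0 : ℝ) < n + 1 := by positivity
    rw [norm_div, Real.norm_eq_abs, Real.norm_eq_abs, abs_of_pos hn, mul_one_div]
    gcongr
    exact (abs_sub _ _).trans (by linarith [hC (n + 1), hC 0])
  · simpa using tendsto_one_div_add_atTop_nhds_zero_nat.const_mul (2 * C)

theorem cesaro_eval_add {f : ℕ → ℝ} (hf : IsBddFun f) (k : ℕ) :
    cesaro.eval (fun n => f (n + k)) = cesaro.eval f := by
  induction k with
  | zero => rfl
  | succ k ih =>
    rw [← ih, ← cesaro_eval_succ (hf.comp fun n => n + k)]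
    simp only [add_right_comm, add_assoc]

/-! ### Invariant means and commutative monoids. -/

variable {M : Type*} [Monoid M]

/-- Left translation by `a` preserves the mean. -/
def IsInvariantUnder (m : FinAddMean M) (a : M) : Prop :=
  ∀ f, IsBddFun f → m.eval (fun x => f (a * x)) = m.eval f

theorem IsInvariantUnder.one (m : FinAddMean M) : m.IsInvariantUnder 1 := fun f _ => by
  simp only [one_mul]

theorem IsInvariantUnder.mul {m : FinAddMean M} {a b : M} (ha : m.IsInvariantUnder a)
    (hb : m.IsInvariantUnder b) : m.IsInvariantUnder (a * b) := fun f hf => by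
  rw [← ha f hf, ← hb (fun x => f (a * x)) (hf.comp _)]
  simp only [mul_assoc]

/-- Commutative monoids have invariant means. -/
theorem exists_isInvariantUnder_of_comm (T : Type*) [CommMonoid T] :
    ∃ m : FinAddMean T, ∀ a, m.IsInvariantUnder a := by
  classical
  have fin : ∀ A : Finset T, ∃ m : FinAddMean T, ∀ a ∈ A, m.IsInvariantUnder a := by
    intro A
    induction A using Finset.induction_on with
    | empty => exact ⟨pure 1, by simp⟩
    | insert a A _ ih =>
      obtain ⟨m, hm⟩ := ih
      -- Averaging the translates $a^k m$ over $k$ creates invariance under $a$; commutativity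
      -- preserves the invariance under the earlier elements.
      refine ⟨cesaro.bind fun k => m.map (a ^ k * ·), fun b hb f hf => ?_⟩
      rcases Finset.mem_insert.1 hb with rfl | hb
      · have := cesaro_eval_succ (isBddFun_eval (fun k : ℕ => m.map (b ^ k * ·))
          (hf.imp fun _ h _ => h))
        simpa only [bind, map, pure, pow_succ', mul_assoc] using this
      · simp only [bind, map, pure]
        congr 1
        ext k
        rw [← hm b hb (fun x => f (a ^ k * x)) (hf.comp _)]
        simp only [mul_left_comm]
  choose m hm using fin
  -- The limit is over finite sets ordered by inclusion: each $a$ lies in $A$ eventually.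
  refine ⟨(ofUltrafilter (Ultrafilter.of atTop)).bind m, fun a f hf => ?_⟩
  refine ofUltrafilter_eval_eq _ (isBddFun_eval _ ((hf.comp _).imp fun _ h _ => h))
    (isBddFun_eval _ (hf.imp fun _ h _ => h)) ?_
  refine Tendsto.mono_left ?_ (Ultrafilter.of_le _)
  refine tendsto_const_nhds.congr' ?_
  filter_upwards [eventually_ge_atTop {a}] with A hA
  rw [hm A a (hA (Finset.mem_singleton_self a)) f hf, sub_self]

/-! ### Face relations -/

section Face

variable (s : ℕ → M)

/-- The law of `s (n - 1) ^ g (n - 1) * ⋯ * s 0 ^ g 0` for independent exponents, the mean over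
`g i` being taken inside that over `g j` for `j < i`. -/
noncomputable def faceMean : ℕ → FinAddMean M
  | 0 => pure 1
  | n + 1 => (faceMean n).bind fun w => cesaro.map fun g => s n ^ g * w

theorem faceMean_succ_eval (n : ℕ) (f : M → ℝ) :
    (faceMean s (n + 1)).eval f =
      (faceMean s n).eval fun w => cesaro.eval fun g => f (s n ^ g * w) := rfl

variable {s}

/-- Induction on $n$ peels off the leftmost power: the relation moves $s_i$ past it with the index
lowered by one, until only the powers of $s_{i+1}$ and $s_i$ matter. -/
theorem faceMean_succ_eval_mul (hs : ∀ i j, i ≤ j → s j * s i = s i * s (j + 1)) (i n : ℕ)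
    (hn : i < n) {f : M → ℝ} (hf : IsBddFun f) :
    (faceMean s (n + 1)).eval (fun x => f (s i * x)) = (faceMean s n).eval f := by
  have pow : ∀ j g, i ≤ j → s i * s (j + 1) ^ g = s j ^ g * s i := fun j g h =>
    ((show SemiconjBy (s i) (s (j + 1)) (s j) from (hs i j h).symm).pow_right g)
  induction n, hn using Nat.le_induction generalizing f with
  | base =>
    rw [faceMean_succ_eval, Nat.succ_eq_add_one, faceMean_succ_eval, faceMean_succ_eval]
    congr 1
    ext w
    -- The word is $s_i^{g+h+1}w$, so the inner mean over $g$ does not depend on $h$ and the outer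
    -- mean over $h$ is that of a constant.
    have : ∀ h : ℕ, (cesaro.eval fun g => f (s i * (s (i + 1) ^ g * (s i ^ h * w)))) =
        cesaro.eval fun g => f (s i ^ g * w) := fun h => by
      rw [← cesaro_eval_add (hf.comp fun g => s i ^ g * w) (h + 1)]
      congr 1
      ext g
      rw [← mul_assoc, pow i g le_rfl, add_comm h, ← add_assoc, pow_add, pow_succ]
      simp only [mul_assoc]
    simp only [this, eval_const]
  | succ n hn ih =>
    have bdd : IsBddFun fun w => cesaro.eval fun g => f (s n ^ g * w) :=
      isBddFun_eval (fun _ => cesaro) (hf.imp fun _ h _ _ => h _)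
    rw [faceMean_succ_eval s (n + 1), faceMean_succ_eval s n f, ← ih bdd]
    congr 1
    ext w
    congr 1
    ext g
    rw [← mul_assoc, pow n g (Nat.le_of_succ_le hn), mul_assoc]

theorem exists_isInvariantUnder_of_face (hs : ∀ i j, i ≤ j → s j * s i = s i * s (j + 1)) :
    ∃ m : FinAddMean M, ∀ i, m.IsInvariantUnder (s i) := by
  refine ⟨cesaro.bind (faceMean s), fun i f hf => ?_⟩
  have bdd : ∀ {f : M → ℝ}, IsBddFun f → IsBddFun fun n => (faceMean s n).eval f := fun hf =>
    isBddFun_eval (faceMean s) (hf.imp fun _ h _ => h)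
  change cesaro.eval (fun n => (faceMean s n).eval fun x => f (s i * x)) =
    cesaro.eval fun n => (faceMean s n).eval f
  -- Shifts by $i+2$ and $i+1$ make the index $n+i+1$ exceed $i$ and supply the drop from
  -- $\mu_{n+1}$ to $\mu_n$.
  rw [← cesaro_eval_add (bdd (hf.comp _)) (i + 1 + 1), ← cesaro_eval_add (bdd hf) (i + 1)]
  congr 1
  ext n
  exact faceMean_succ_eval_mul hs i (n + (i + 1)) (by lia) hf

end Face

end FinAddMean

/-! ### Invariant means on the facial monoid and on semidirect products. -/

open FinAddMean

theorem FacialMonoid.exists_isInvariantUnder :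
    ∃ m : FinAddMean FacialMonoid, ∀ a, m.IsInvariantUnder a := by
  obtain ⟨m, hm⟩ := exists_isInvariantUnder_of_face
    (s := fun i : ℕ => PresentedMonoid.of FacialRel i.succPNat) fun i j h =>
      PresentedMonoid.mk_eq_mk_of_rel (.face _ _ (Nat.succPNat_le_succPNat.2 h))
  refine ⟨m, fun a => ?_⟩
  have ha : a ∈ Submonoid.closure (Set.range (PresentedMonoid.of FacialRel)) := by
    rw [PresentedMonoid.closure_range_of]
    trivial
  induction ha using Submonoid.closure_induction with
  | mem a ha =>
    obtain ⟨i, rfl⟩ := ha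
    simpa using hm i.natPred
  | one => exact .one m
  | mul a b _ _ ha hb => exact ha.mul hb

/-- The mean over $T$ is taken inside: for fixed $s$ it absorbs the factor $a_T^{\,s}$, whatever
that element is, and then the mean over $S$ absorbs $a_S$. -/
theorem RightSemidirectProduct.exists_isInvariantUnder {S T : Type*} [Monoid S] [Monoid T]
    (φ : S →* (Monoid.End T)ᵐᵒᵖ) (hS : ∃ m : FinAddMean S, ∀ a, m.IsInvariantUnder a)
    (hT : ∃ m : FinAddMean T, ∀ a, m.IsInvariantUnder a) :
    ∃ m : FinAddMean (RightSemidirectProduct S T φ), ∀ a, m.IsInvariantUnder a := by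
  obtain ⟨m, hm⟩ := hS
  obtain ⟨l, hl⟩ := hT
  refine ⟨m.bind fun s => l.map fun t => ⟨s, t⟩, fun a f hf => ?_⟩
  have bdd : IsBddFun fun s => l.eval fun t => f ⟨s, t⟩ :=
    isBddFun_eval (fun _ => l) (hf.imp fun _ h _ _ => h _)
  refine Eq.trans ?_ (hm a.left _ bdd)
  change m.eval (fun s => l.eval fun t => f (a * ⟨s, t⟩)) = _
  congr 1
  ext s
  exact hl ((φ s).unop a.right) (fun t => f ⟨a.left * s, t⟩) (hf.comp _)

/-! ### Day's theorem -/

section Day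

variable {M : Type u} [Monoid M]

theorem FinAddMean.hasLeftInvariantMean (m : FinAddMean M) (hm : ∀ a, m.IsInvariantUnder a) :
    HasLeftInvariantMean M := by
  have bdd : ∀ f : lp (fun _ : M => ℝ) ∞, IsBddFun f := fun f => by
    obtain ⟨C, hC⟩ := memℓp_infty_iff.1 f.2
    exact ⟨C, fun x => hC ⟨x, rfl⟩⟩
  exact ⟨{  toFun := fun f => m.eval f
            map_add' := fun f g => m.eval_add f g (bdd f) (bdd g)
            map_smul' := fun c f => m.eval_const_mul c f (bdd f) },
    fun f hf => m.eval_nonneg f (bdd f) hf, m.eval_one, fun a f => hm a f (bdd f)⟩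

/-- The canonical map from finitely supported functions to `ℓ¹`. -/
noncomputable def finsuppToLpOne (α : Type*) [DecidableEq α] : (α →₀ ℝ) →ₗ[ℝ] lp (fun _ : α => ℝ) 1 :=
  Finsupp.lsum ℝ fun x => lp.lsingle (E := fun _ : α => ℝ) 1 x

theorem finsuppToLpOne_single {α : Type*} [DecidableEq α] (x : α) (r : ℝ) :
    finsuppToLpOne α (Finsupp.single x r) = r • lp.single 1 x 1 := by
  rw [← lp.single_smul, smul_eq_mul, mul_one]
  exact Finsupp.sum_single_index (lp.single_zero 1 x)

theorem norm_finsuppToLpOne {α : Type*} [DecidableEq α] (μ : α →₀ ℝ) :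
    ‖finsuppToLpOne α μ‖ = μ.sum fun _ r => |r| := by
  have := lp.norm_sum_single (p := 1) (E := fun _ : α => ℝ) (by simp) μ μ.support
  simp only [ENNReal.toReal_one, Real.rpow_one, Real.norm_eq_abs] at this
  exact this

/-- The vectors $(a\mu-\mu)_{a\in A}$ form a convex subset of $\ell^1(M)^A$. If $0$ were not in its
norm closure, a separating functional would give bounded $g_a$ with $\sum_a(g_a(ax)-g_a(x))\ge r>0$
for all $x$, yet the invariant mean of the left side is $0$. -/
theorem FinAddMean.hasReiterProperty (m : FinAddMean M) (hm : ∀ a, m.IsInvariantUnder a) :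
    HasReiterProperty M := by
  classical
  intro A ε hε
  let L : (M →₀ ℝ) →ₗ[ℝ] (A → lp (fun _ : M => ℝ) 1) :=
    LinearMap.pi fun a => finsuppToLpOne M ∘ₗ
      (Finsupp.lmapDomain ℝ ℝ (fun x => (a : M) * x) - LinearMap.id)
  let P : Set (M →₀ ℝ) := {μ | (∀ x, 0 ≤ μ x) ∧ (μ.sum fun _ r => r) = 1}
  have hP : Convex ℝ P := by
    intro μ hμ ν hν s t hs ht hst
    refine ⟨fun x => ?_, ?_⟩
    · have := hμ.1 x
      have := hν.1 x
      simp only [Finsupp.add_apply, Finsupp.smul_apply, smul_eq_mul]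
      positivity
    · rw [Finsupp.sum_add_index' (fun _ => rfl) (fun _ _ _ => rfl),
        Finsupp.sum_smul_index' (fun _ => rfl), Finsupp.sum_smul_index' (fun _ => rfl)]
      simp only [smul_eq_mul, ← Finsupp.mul_sum, hμ.2, hν.2, mul_one, hst]
  have h0 : (0 : A → lp (fun _ : M => ℝ) 1) ∈ closure (L '' P) := by
    by_contra h0
    obtain ⟨F, r, hr, hF⟩ := geometric_hahn_banach_point_closed
      (hP.linear_image L).closure isClosed_closure h0
    rw [map_zero] at hr
    let g : A → M → ℝ := fun a x => F (Pi.single a (lp.single 1 x 1))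
    have hg : ∀ a, IsBddFun (g a) := fun a => ⟨‖F‖, fun x => by
      refine (F.le_opNorm _).trans (mul_le_of_le_one_right (norm_nonneg _) ?_)
      rw [Pi.norm_single, lp.norm_single one_pos, norm_one]⟩
    have key : ∀ x, r ≤ ∑ a : A, (g a (a * x) - g a x) := fun x => by
      have hx : Finsupp.single x (1 : ℝ) ∈ P :=
        ⟨fun y => by rw [Finsupp.single_apply]; split_ifs <;> norm_num, by simp⟩
      refine (hF _ (subset_closure ⟨_, hx, rfl⟩)).le.trans_eq ?_
      rw [← Finset.univ_sum_single (L (Finsupp.single x 1)), map_sum]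
      refine Finset.sum_congr rfl fun a _ => ?_
      simp only [g, ← map_sub, ← Pi.single_sub]
      simp [L, Finsupp.mapDomain_single, finsuppToLpOne_single]
    have hsum := m.eval_sum Finset.univ (fun (a : A) x => g a (a * x) - g a x)
      fun a => ((hg a).comp _).sub (hg a)
    have := m.eval_mono (.const r) hsum.1 key
    rw [m.eval_const, hsum.2, Finset.sum_eq_zero fun a _ => ?_] at this
    · exact hr.not_ge this
    · rw [m.eval_sub ((hg a).comp _) (hg a), hm a _ (hg a), sub_self]
  obtain ⟨_, ⟨μ, hμ, rfl⟩, hlt⟩ := Metric.mem_closure_iff.1 h0 ε hε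
  refine ⟨μ, hμ.1, hμ.2, fun a ha => ?_⟩
  rw [← norm_finsuppToLpOne]
  rw [dist_zero_left] at hlt
  exact (norm_le_pi_norm (L μ) ⟨a, ha⟩).trans_lt hlt

end Day


/-! ### From almost invariant measures to fixed points. -/

section FixedPoint

open Filter Topology

variable {M : Type u} [Monoid M] {V : Type v} [AddCommGroup V] [Module ℝ V]

theorem Convex.exists_sum_smul_eq {ι : Type*} {K : Set V} (hK : Convex ℝ K) (hne : K.Nonempty)
    (s : Finset ι) {w : ι → ℝ} (hw : ∀ i ∈ s, 0 ≤ w i) {z : ι → V} (hz : ∀ i ∈ s, z i ∈ K) :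
    ∃ k ∈ K, ∑ i ∈ s, w i • z i = (∑ i ∈ s, w i) • k := by
  rcases (Finset.sum_nonneg hw).eq_or_lt with h | h
  · obtain ⟨k, hk⟩ := hne
    refine ⟨k, hk, ?_⟩
    rw [← h, zero_smul]
    refine Finset.sum_eq_zero fun i hi => ?_
    rw [(Finset.sum_eq_zero_iff_of_nonneg hw).1 h.symm i hi, zero_smul]
  · refine ⟨s.centerMass w z, hK.centerMass_mem hw h hz, ?_⟩
    rw [Finset.centerMass, smul_inv_smul₀ h.ne']

/-- Positive and negative parts of $\nu$ have equal mass $\|\nu\|_1/2$. This controls the sum by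
$K-K$ and so avoids local convexity. -/
theorem Convex.exists_finsuppSum_smul_eq {ι : Type*} {K : Set V} (hK : Convex ℝ K)
    (hne : K.Nonempty) (ν : ι →₀ ℝ) (hν : (ν.sum fun _ r => r) = 0) {z : ι → V}
    (hz : ∀ i, z i ∈ K) :
    ∃ k ∈ K, ∃ l ∈ K, (ν.sum fun i r => r • z i) = ((ν.sum fun _ r => |r|) / 2) • (k - l) := by
  obtain ⟨k, hk, hk'⟩ := hK.exists_sum_smul_eq hne ν.support (w := fun i => (ν i)⁺)
    (fun i _ => posPart_nonneg _) (fun i _ => hz i)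
  obtain ⟨l, hl, hl'⟩ := hK.exists_sum_smul_eq hne ν.support (w := fun i => (ν i)⁻)
    (fun i _ => negPart_nonneg _) (fun i _ => hz i)
  refine ⟨k, hk, l, hl, ?_⟩
  have h1 : ∑ i ∈ ν.support, (ν i)⁺ - ∑ i ∈ ν.support, (ν i)⁻ = 0 := by
    rw [← Finset.sum_sub_distrib, ← hν]
    exact Finset.sum_congr rfl fun i _ => posPart_sub_negPart _
  have h2 : ∑ i ∈ ν.support, (ν i)⁺ + ∑ i ∈ ν.support, (ν i)⁻ = ν.sum fun _ r => |r| := by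
    rw [← Finset.sum_add_distrib]
    exact Finset.sum_congr rfl fun i _ => posPart_add_negPart _
  have h3 : ∑ i ∈ ν.support, (ν i)⁺ = (ν.sum fun _ r => |r|) / 2 := by linarith
  have h4 : ∑ i ∈ ν.support, (ν i)⁻ = (ν.sum fun _ r => |r|) / 2 := by linarith
  rw [h3] at hk'
  rw [h4] at hl'
  rw [smul_sub, ← hk', ← hl', ← Finset.sum_sub_distrib]
  refine Finset.sum_congr rfl fun i _ => ?_
  rw [← sub_smul, posPart_sub_negPart]

/-- The fixed point is a limit of the barycentres $x_p$ of the images of $\mu_p$ under $s\mapsto s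
x_0$. -/
theorem HasReiterProperty.hasFixedPointProperty (h : HasReiterProperty M) :
    HasFixedPointProperty.{u, v} M := by
  classical
  intro V _ _ _ _ _ _ act _ hmul K hne hK hconv hact
  obtain ⟨x₀, hx₀⟩ := hne
  choose μ hμ0 hμ1 hμ using fun p : Finset M × ℕ =>
    h p.1 (1 / ((p.2 : ℝ) + 1)) (by positivity)
  let x : Finset M × ℕ → V := fun p => (μ p).sum fun s r => r • act s x₀
  have hxK : ∀ p, x p ∈ K := fun p =>
    hconv.sum_mem (fun s _ => hμ0 p s) (hμ1 p) fun s _ => hact s _ hx₀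
  let U : Ultrafilter (Finset M × ℕ) := .of atTop
  have hU : (U : Filter (Finset M × ℕ)) ≤ atTop := Ultrafilter.of_le _
  obtain ⟨y, hyK, hy⟩ := hK.ultrafilter_le_nhds' (U.map x)
    (Ultrafilter.mem_map.2 (Filter.univ_mem' hxK))
  refine ⟨y, hyK, fun a => ?_⟩
  let ν : Finset M × ℕ → M →₀ ℝ := fun p => (μ p).mapDomain (fun s => a * s) - μ p
  have hsub : ∀ (p) (z : M → V), ((ν p).sum fun s r => r • z s) =
      ((μ p).sum fun s r => r • z (a * s)) - (μ p).sum fun s r => r • z s := fun p z => by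
    rw [Finsupp.sum_sub_index fun _ _ _ => sub_smul _ _ _,
      Finsupp.sum_mapDomain_index (h := fun s r => r • z s) (fun _ => zero_smul _ _)
        fun _ _ _ => add_smul _ _ _]
  have hν0 : ∀ p, ((ν p).sum fun _ r => r) = 0 := fun p => by
    rw [Finsupp.sum_sub_index fun _ _ _ => rfl,
      Finsupp.sum_mapDomain_index (fun _ => rfl) fun _ _ _ => rfl, sub_self]
  have hactx : ∀ p, act a (x p) - x p = (ν p).sum fun s r => r • act s x₀ := fun p => by
    have dec : ∀ z, act a z = (act a).contLinear z + act a 0 := fun z => by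
      simpa using (act a).map_vadd 0 z
    rw [hsub]
    congr 1
    -- As $\mu_p$ has total mass $1$, the constant term of the affine map distributes over the sum.
    have h1 : act a 0 = (μ p).sum fun _ r => r • act a 0 := by
      have := congrArg (· • act a 0) (hμ1 p)
      simpa only [Finsupp.sum, Finset.sum_smul, one_smul] using this.symm
    simp only [hmul, dec (act _ x₀), smul_add, Finsupp.sum_add]
    rw [dec, ← h1, map_finsuppSum]
    simp only [map_smul]
  choose k hk l hl hkl using fun p =>
    hconv.exists_finsuppSum_smul_eq ⟨x₀, hx₀⟩ (ν p) (hν0 p) (z := fun s => act s x₀)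
      fun s => hact s _ hx₀
  have hc : Tendsto (fun p => ((ν p).sum fun _ r => |r|) / 2) atTop (𝓝 0) := by
    have hlim : Tendsto (fun p : Finset M × ℕ => 1 / ((p.2 : ℝ) + 1)) atTop (𝓝 0) := by
      rw [← prod_atTop_atTop_eq]
      exact tendsto_one_div_add_atTop_nhds_zero_nat.comp tendsto_snd
    refine squeeze_zero' (.of_forall fun p => ?_) ?_ hlim
    · exact div_nonneg (Finset.sum_nonneg fun _ _ => abs_nonneg _) zero_le_two
    · filter_upwards [eventually_ge_atTop (({a}, 0) : Finset M × ℕ)] with p hp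
      have h1 := hμ p a (hp.1 (Finset.mem_singleton_self a))
      have h2 : 0 ≤ (ν p).sum fun _ r => |r| := Finset.sum_nonneg fun _ _ => abs_nonneg _
      change (ν p).sum (fun _ r => |r|) < _ at h1
      linarith
  -- A compact set is von Neumann bounded, so scalars tending to $0$ times points of $K$ tend to
  -- $0$.
  have hzero : Tendsto (fun p => act a (x p) - x p) U (𝓝 0) := by
    have h1 := hK.isVonNBounded ℝ |>.smul_tendsto_zero (.of_forall hk) (hc.mono_left hU)
    have h2 := hK.isVonNBounded ℝ |>.smul_tendsto_zero (.of_forall hl) (hc.mono_left hU)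
    have h3 := h1.sub h2
    rw [sub_zero] at h3
    refine h3.congr fun p => ?_
    rw [hactx, hkl, smul_sub]
    rfl
  have hlim : Tendsto (fun p => act a (x p) - x p) U (𝓝 (act a y - y)) :=
    (((act a).continuous.tendsto y).comp hy).sub hy
  exact sub_eq_zero.1 (tendsto_nhds_unique hlim hzero)

end FixedPoint

theorem FinAddMean.isAmenable {M : Type u} [Monoid M] (m : FinAddMean M)
    (hm : ∀ a, m.IsInvariantUnder a) : IsAmenable.{u, v} M where
  fixedPoint := (m.hasReiterProperty hm).hasFixedPointProperty
  leftInvariantMean := m.hasLeftInvariantMean hm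
  reiter := m.hasReiterProperty hm

theorem facialSemidirect_isAmenable (R : Type) [AddCommMonoid R] :
    IsAmenable.{0, v}
      (RightSemidirectProduct FacialMonoid (Multiplicative (ℕ+ →₀ R)) (facialAction R)) := by
  obtain ⟨m, hm⟩ := RightSemidirectProduct.exists_isInvariantUnder (facialAction R)
    FacialMonoid.exists_isInvariantUnder
    (FinAddMean.exists_isInvariantUnder_of_comm (Multiplicative (ℕ+ →₀ R)))
  exact m.isAmenable hm

theorem mainTheorem10 :
    IsAmenable.{0, v}
        (RightSemidirectProduct FacialMonoid (Multiplicative (ℕ+ →₀ ℕ)) (facialAction ℕ)) ∧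
      IsAmenable.{0, v}
        (RightSemidirectProduct FacialMonoid (Multiplicative (ℕ+ →₀ ℤ)) (facialAction ℤ)) :=
  ⟨facialSemidirect_isAmenable ℕ, facialSemidirect_isAmenable ℤ⟩
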